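/- Let $\Gamma$ be a topological group acting continuously on a compact metric space $X$. Let $E(X,\Gamma)$ be the enveloping semigroup, i.e. the closure of the set of maps $\{x\mapsto\gamma x:\gamma\in\Gamma\}$ in $X^X$ with the product topology. The system $(X,\Gamma)$ is \emph{tame} if the space $E(X,\Gamma)$ is separable and Fréchet (every point in the closure of a subset $A$ is the limit of a sequence of points of $A$). It is \emph{injective} if the natural map $E(M(X),\Gamma)\to E(X,\Gamma)$ is an isomorphism; here $M(X)$ is the space of Borel probability measures on $X$ with the weak$^*$ topology and the push-forward action of $\Gamma$, and the natural map sends $p$ to the map $q$ with $p(\delta_x)=\delta_{q(x)}$ for all $x\in X$. (1) If $(X,\Gamma)$ is minimal (every orbit is dense) and distal ($\inf_{\gamma\in\Gamma} d(\gamma x,\gamma y)>0$ whenever $x\ne y$), then $(X,\Gamma)$ is tame if and only if it is equicontinuous. (2) For every irrational $\alpha\in\mathbb{R}$, the $\mathbb{Z}$-system on the two-torus $\mathbb{T}^2=(\mathbb{R}/\mathbb{Z})^2$ generated by the homeomorphism $T(x,y)=(x+\alpha,\,y+x)$ is minimal, distal and not equicontinuous, and it is neither tame nor injective. -/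

import Mathlib

set_option linter.unusedSectionVars false

open Set Filter Topology MeasureTheory

namespace TopDyn

/-! ### Dynamical systems `(X, Γ)` : a group `Γ` acting by homeomorphisms on `X` -/

section Basic

variable (Γ : Type*) (X : Type*) [Group Γ] [MulAction Γ X]

/-- Two points are proximal if some elements of the group bring them arbitrarily close
(with respect to the uniformity). -/
def Proximal [UniformSpace X] (x y : X) : Prop :=
  ∀ V ∈ uniformity X, ∃ g : Γ, (g • x, g • y) ∈ V

/-- A system is distal if it has no proximal pairs of distinct points. -/
def IsDistal [UniformSpace X] : Prop :=
  ∀ x y : X, Proximal Γ X x y → x = y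

/-- A system is equicontinuous if the acting group is an equicontinuous family of maps. -/
def IsEquicontinuous [UniformSpace X] : Prop :=
  Equicontinuous (fun (g : Γ) (x : X) => g • x)

/-- The enveloping (Ellis) semigroup `E(X, Γ)`: the closure of the set of translations
`x ↦ g • x`, `g ∈ Γ`, in the space `X → X` with the product topology. -/
def envelopingSemigroup [TopologicalSpace X] : Set (X → X) :=
  closure (range (fun (g : Γ) (x : X) => g • x))

/-- A system is tame if its enveloping semigroup (as a topological space) is separable and
Fréchet: every point in the closure of a set is the limit of a sequence of points of the set. -/
def IsTame [TopologicalSpace X] : Prop :=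
  TopologicalSpace.SeparableSpace (envelopingSemigroup Γ X) ∧
    FrechetUrysohnSpace (envelopingSemigroup Γ X)

variable {Γ X}
variable [TopologicalSpace X]

theorem smul_mem_envelopingSemigroup (g : Γ) :
    (fun x : X => g • x) ∈ envelopingSemigroup Γ X :=
  subset_closure ⟨g, rfl⟩

theorem comp_mem_envelopingSemigroup [ContinuousConstSMul Γ X] {p q : X → X}
    (hp : p ∈ envelopingSemigroup Γ X) (hq : q ∈ envelopingSemigroup Γ X) :
    p ∘ q ∈ envelopingSemigroup Γ X := by
  have h1 : ∀ g : Γ, (fun x : X => g • q x) ∈ envelopingSemigroup Γ X := by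
    intro g
    have hc : Continuous (fun (r : X → X) (x : X) => g • r x) :=
      continuous_pi fun x => (continuous_apply x).const_smul g
    refine map_mem_closure hc hq ?_
    rintro _ ⟨h, rfl⟩
    exact ⟨g * h, by funext x; simp [mul_smul]⟩
  have hc : Continuous (fun (r : X → X) => r ∘ q) :=
    continuous_pi fun x => continuous_apply (q x)
  have := map_mem_closure hc hp (t := envelopingSemigroup Γ X) (by
    rintro _ ⟨g, rfl⟩
    exact h1 g)
  rwa [envelopingSemigroup, closure_closure] at this

/-- The semigroup structure on `E(X, Γ)` is composition of maps. -/
instance [ContinuousConstSMul Γ X] : Semigroup (envelopingSemigroup Γ X) where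
  mul p q := ⟨p.1 ∘ q.1, comp_mem_envelopingSemigroup p.2 q.2⟩
  mul_assoc _ _ _ := rfl

/-- `Γ` acts on `E(X, Γ)` by composition on the left. -/
instance [ContinuousConstSMul Γ X] : MulAction Γ (envelopingSemigroup Γ X) where
  smul g p := ⟨fun x => g • p.1 x,
    comp_mem_envelopingSemigroup (smul_mem_envelopingSemigroup g) p.2⟩
  one_smul p := Subtype.ext (funext fun x => one_smul Γ (p.1 x))
  mul_smul g h p := Subtype.ext (funext fun x => mul_smul g h (p.1 x))

end Basic

/-! ### The induced system `(M(X), Γ)` on Borel probability measures, and injectivity -/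

section Measures

variable {Γ : Type*} {X : Type*} [Group Γ] [MulAction Γ X]
variable [MetricSpace X] [CompactSpace X] [MeasurableSpace X] [BorelSpace X]
variable [ContinuousConstSMul Γ X]

/-- `Γ` acts on `M(X) = ProbabilityMeasure X` (with its weak topology) by push-forward. -/
noncomputable instance : MulAction Γ (ProbabilityMeasure X) where
  smul g μ := μ.map (f := fun x : X => g • x) (continuous_const_smul g).measurable.aemeasurable
  one_smul μ := by
    apply Subtype.ext
    change Measure.map (fun x : X => (1 : Γ) • x) (μ : Measure X) = μ
    simp
  mul_smul g h μ := by
    apply Subtype.ext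
    change Measure.map (fun x : X => (g * h) • x) (μ : Measure X) =
      Measure.map (fun x : X => g • x) (Measure.map (fun x : X => h • x) (μ : Measure X))
    rw [Measure.map_map (continuous_const_smul g).measurable (continuous_const_smul h).measurable]
    simp only [mul_smul, Function.comp_def]

instance : ContinuousConstSMul Γ (ProbabilityMeasure X) where
  continuous_const_smul g :=
    ProbabilityMeasure.continuous_map (f := fun x : X => g • x) (continuous_const_smul g)

theorem smul_diracProba (g : Γ) (x : X) : g • diracProba x = diracProba (g • x) := by
  apply Subtype.ext
  exact Measure.map_dirac' (continuous_const_smul g).measurable x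

/-- Elements of `E(M(X), Γ)` map Dirac measures to Dirac measures. -/
theorem exists_apply_diracProba (p : envelopingSemigroup Γ (ProbabilityMeasure X)) (x : X) :
    ∃ y : X, p.1 (diracProba x) = diracProba y := by
  have hcl : IsClosed (range (diracProba : X → ProbabilityMeasure X)) :=
    (isCompact_range continuous_diracProba).isClosed
  have hc : Continuous
      (fun r : ProbabilityMeasure X → ProbabilityMeasure X => r (diracProba x)) :=
    continuous_apply _
  have := map_mem_closure hc p.2 (t := range (diracProba : X → ProbabilityMeasure X)) (by
    rintro _ ⟨g, rfl⟩
    exact ⟨g • x, (smul_diracProba g x).symm⟩)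
  rw [hcl.closure_eq] at this
  obtain ⟨y, hy⟩ := this
  exact ⟨y, hy.symm⟩

/-- The self-map of `X` obtained by restricting `p ∈ E(M(X), Γ)` to the Dirac measures. -/
noncomputable def restrictDirac (p : envelopingSemigroup Γ (ProbabilityMeasure X)) (x : X) : X :=
  (exists_apply_diracProba p x).choose

theorem diracProba_restrictDirac (p : envelopingSemigroup Γ (ProbabilityMeasure X)) (x : X) :
    diracProba (restrictDirac p x) = p.1 (diracProba x) :=
  (exists_apply_diracProba p x).choose_spec.symm

theorem restrictDirac_mem (p : envelopingSemigroup Γ (ProbabilityMeasure X)) :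
    restrictDirac p ∈ envelopingSemigroup Γ X := by
  have hind : IsInducing
      (fun (f : X → X) (x : X) => (diracProba (f x) : ProbabilityMeasure X)) :=
    IsInducing.piMap (fun _ : X => (isEmbedding_diracProba (X := X)).isInducing)
  rw [envelopingSemigroup, hind.closure_eq_preimage_closure_image, mem_preimage]
  have hc : Continuous (fun (r : ProbabilityMeasure X → ProbabilityMeasure X) (x : X) =>
      r (diracProba x)) := continuous_pi fun x => continuous_apply _
  have := map_mem_closure hc p.2 (t := (fun (f : X → X) (x : X) => diracProba (f x)) ''
      range (fun (g : Γ) (x : X) => g • x)) (by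
    rintro _ ⟨g, rfl⟩
    exact ⟨_, ⟨g, rfl⟩, funext fun x => (smul_diracProba g x).symm⟩)
  simpa only [diracProba_restrictDirac] using this

variable (Γ X)

/-- The natural semigroup homomorphism `E(M(X), Γ) → E(X, Γ)`, given by restriction to the
Dirac measures. -/
noncomputable def naturalMap :
    envelopingSemigroup Γ (ProbabilityMeasure X) →ₙ* envelopingSemigroup Γ X where
  toFun p := ⟨restrictDirac p, restrictDirac_mem p⟩
  map_mul' p q := by
    refine Subtype.ext (funext fun x => injective_diracProba (X := X) ?_)
    change diracProba (restrictDirac (p * q) x) =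
      diracProba (restrictDirac p (restrictDirac q x))
    simp only [diracProba_restrictDirac]
    rfl

/-- The natural map is a map of `Γ`-systems. -/
theorem naturalMap_smul (g : Γ) (p : envelopingSemigroup Γ (ProbabilityMeasure X)) :
    naturalMap Γ X (g • p) = g • naturalMap Γ X p := by
  refine Subtype.ext (funext fun x => injective_diracProba (X := X) ?_)
  change diracProba (restrictDirac (g • p) x) = diracProba (g • restrictDirac p x)
  rw [← smul_diracProba, diracProba_restrictDirac, diracProba_restrictDirac]
  rfl

/-- A system is injective if the natural map `E(M(X), Γ) → E(X, Γ)`, which is an equivariant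
semigroup homomorphism, is an isomorphism, i.e. also a homeomorphism. -/
def IsInjective : Prop :=
  IsHomeomorph (naturalMap Γ X)

end Measures

/-! ### The skew product on the two-torus -/

/-- The homeomorphism `(x, y) ↦ (x + α, y + x)` of the two-torus `(ℝ/ℤ)²`. -/
def skewHomeo (α : ℝ) : (UnitAddCircle × UnitAddCircle) ≃ₜ (UnitAddCircle × UnitAddCircle) where
  toFun z := (z.1 + (α : UnitAddCircle), z.2 + z.1)
  invFun z := (z.1 - (α : UnitAddCircle), z.2 - (z.1 - (α : UnitAddCircle)))
  left_inv z := by simp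
  right_inv z := by simp
  continuous_toFun := by fun_prop
  continuous_invFun := by fun_prop

/-- The two-torus, regarded as the phase space of the `ℤ`-system generated by `skewHomeo α`. -/
def SkewTorus (_α : ℝ) : Type := UnitAddCircle × UnitAddCircle

section Skew

variable (α : ℝ)

noncomputable instance : MetricSpace (SkewTorus α) :=
  inferInstanceAs (MetricSpace (UnitAddCircle × UnitAddCircle))

instance : CompactSpace (SkewTorus α) :=
  inferInstanceAs (CompactSpace (UnitAddCircle × UnitAddCircle))

noncomputable instance : MeasurableSpace (SkewTorus α) := borel (SkewTorus α)

instance : BorelSpace (SkewTorus α) := ⟨rfl⟩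

/-- The action of `ℤ` (written multiplicatively): `n` acts as the `n`-th iterate of
`(x, y) ↦ (x + α, y + x)`. -/
instance : MulAction (Multiplicative ℤ) (SkewTorus α) where
  smul n z := (skewHomeo α ^ n.toAdd) z
  one_smul _ := rfl
  mul_smul m n z := congrArg (fun h : (UnitAddCircle × UnitAddCircle) ≃ₜ
    (UnitAddCircle × UnitAddCircle) => h z) (zpow_add (skewHomeo α) m.toAdd n.toAdd)

instance : ContinuousConstSMul (Multiplicative ℤ) (SkewTorus α) where
  continuous_const_smul n := (skewHomeo α ^ n.toAdd).continuous

end Skew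

end TopDyn

/-!
Write `E` for the enveloping semigroup `E(X, Γ)`. Composition in `E` is continuous in the left
factor, and if the system is distal then `E` is a group (`IsDistal.exists_inverse`), since the only
idempotent map in `E` is the identity. An equicontinuous system is tame because `E` then consists
of continuous maps, which are determined by their values on a countable dense set.

For the converse, let the system be tame, distal and minimal. Every element of `E` is the limit of
a sequence of translations, and a pointwise limit of a sequence of continuous maps is continuous at
the points of a residual set (`eventually_residual_continuousAt`). The main step is that an element
of `E` is determined by its values on some countable set
(`IsTame.exists_countable_determining`). If not, then for some `ε > 0` and for every countable `F`
there are elements of `E` that fix `F` pointwise and move some point `x` so far that `x` and its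
image stay `ε`-apart under all of `E`. Composing such elements one after the other, and deciding at
each stage whether to use the next one, prescribes the values at more and more points without
changing the earlier ones. This yields an element of `E` that oscillates by `ε / 2` near every point
of a dense subset of a closed set, which a limit of a sequence of continuous maps cannot do.

Hence a left multiplication of `E` is, up to a homeomorphism onto its image, given by countably
many coordinates, and it is continuous at some point by Baire's theorem. Right multiplications are
homeomorphisms of `E` which commute with left multiplications and act transitively, so left
multiplications are continuous everywhere (`IsTame.continuous_mul_left`). By minimality `X` is a
quotient space of `E`, so the elements of `E` are continuous maps, and Baire's theorem on the
compact group `E` gives equicontinuity (`IsDistal.isEquicontinuous_of_continuous`).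

The iterates of the skew product are `(x, y) ↦ (x + n α, y + n x + cₙ)`. Distality and the failure
of equicontinuity are read off from this formula. The stretching of horizontal segments gives
topological transitivity, hence a dense orbit, hence minimality by distality. If the system were
injective, then the elements of `E(M(X), Γ)` would be injective maps, as `E(X, Γ)` is a group. But
consider Lebesgue measure on the horizontal circles of heights `0` and `1 / 2`: translating the
first coordinate by `1 / (2 n)` shows that their images under the `n`-th iterate become weakly
indistinguishable, so a limit point of the iterates in `E(M(X), Γ)` identifies the two measures.
-/

namespace TopDyn

/-! ### The enveloping semigroup of a distal system -/

section Ellis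

variable {Γ X : Type*} [Group Γ] [MulAction Γ X]

theorem id_mem_envelopingSemigroup [TopologicalSpace X] : id ∈ envelopingSemigroup Γ X :=
  subset_closure ⟨1, funext fun x => one_smul Γ x⟩

theorem isCompact_envelopingSemigroup [TopologicalSpace X] [CompactSpace X] :
    IsCompact (envelopingSemigroup Γ X) :=
  isClosed_closure.isCompact

instance [TopologicalSpace X] [CompactSpace X] : CompactSpace (envelopingSemigroup Γ X) :=
  isCompact_iff_compactSpace.mp isCompact_envelopingSemigroup

instance [TopologicalSpace X] : Nonempty (envelopingSemigroup Γ X) :=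
  ⟨⟨id, id_mem_envelopingSemigroup⟩⟩

theorem continuous_mul_right [TopologicalSpace X] [ContinuousConstSMul Γ X]
    (q : envelopingSemigroup Γ X) : Continuous (· * q) :=
  continuous_induced_rng.mpr
    (continuous_pi fun x => (continuous_apply (q.1 x)).comp continuous_subtype_val)

/-- Two points identified by an element of the enveloping semigroup are proximal. -/
theorem proximal_of_apply_eq [UniformSpace X] {p : X → X} (hp : p ∈ envelopingSemigroup Γ X)
    {x y : X} (h : p x = p y) : Proximal Γ X x y := by
  intro V hV
  have hc : ContinuousAt (fun r : X → X => (r x, r y)) p :=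
    ((continuous_apply x).prodMk (continuous_apply y)).continuousAt
  have hn : V ∈ 𝓝 (p x, p y) := by
    rw [h]
    exact nhds_le_uniformity _ hV
  obtain ⟨r, hr, g, rfl⟩ := mem_closure_iff_nhds.mp hp _ (hc hn)
  exact ⟨g, hr⟩

theorem IsDistal.injective [UniformSpace X] (hd : IsDistal Γ X) {p : X → X}
    (hp : p ∈ envelopingSemigroup Γ X) : Function.Injective p :=
  fun _ _ h => hd _ _ (proximal_of_apply_eq hp h)

/-- An idempotent `u` of the enveloping semigroup identifies `x` with `u x`, so it is the
identity if the system is distal; the compact left ideals `E * p` contain idempotents. -/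
theorem IsDistal.exists_comp_eq_id [UniformSpace X] [T2Space X] [CompactSpace X]
    [ContinuousConstSMul Γ X] (hd : IsDistal Γ X) {p : X → X}
    (hp : p ∈ envelopingSemigroup Γ X) :
    ∃ q ∈ envelopingSemigroup Γ X, q ∘ p = id := by
  set P : envelopingSemigroup Γ X := ⟨p, hp⟩
  obtain ⟨_, ⟨q, rfl⟩, hu⟩ := exists_idempotent_in_compact_subsemigroup
    (M := envelopingSemigroup Γ X) continuous_mul_right (range (· * P)) (range_nonempty _)
    (isCompact_range (continuous_mul_right P)) (by
      rintro _ ⟨a, rfl⟩ _ ⟨b, rfl⟩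
      exact ⟨a * P * b, by simp only [mul_assoc]⟩)
  refine ⟨q.1, q.2, funext fun x => ?_⟩
  exact hd.injective (q * P).2 (congrFun (congrArg Subtype.val hu) x)

/-- Ellis' theorem: the enveloping semigroup of a distal system is a group. -/
theorem IsDistal.exists_inverse [UniformSpace X] [T2Space X] [CompactSpace X]
    [ContinuousConstSMul Γ X] (hd : IsDistal Γ X) {p : X → X}
    (hp : p ∈ envelopingSemigroup Γ X) :
    ∃ q ∈ envelopingSemigroup Γ X, q ∘ p = id ∧ p ∘ q = id := by
  obtain ⟨q, hq, hqp⟩ := hd.exists_comp_eq_id hp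
  refine ⟨q, hq, hqp, funext fun x => hd.injective hq ?_⟩
  exact congrFun hqp (q x)

theorem range_eval_eq_closure_orbit [TopologicalSpace X] [T2Space X] [CompactSpace X] (x : X) :
    range (fun p : envelopingSemigroup Γ X => p.1 x) = closure (MulAction.orbit Γ x) := by
  have hc : Continuous (fun p : envelopingSemigroup Γ X => p.1 x) :=
    (continuous_apply x).comp continuous_subtype_val
  refine Subset.antisymm ?_ (closure_minimal ?_ (isCompact_range hc).isClosed)
  · rintro _ ⟨p, rfl⟩
    refine map_mem_closure (f := fun r : X → X => r x) (continuous_apply x) p.2 ?_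
    rintro _ ⟨g, rfl⟩
    exact ⟨g, rfl⟩
  · rintro _ ⟨g, rfl⟩
    exact ⟨⟨_, smul_mem_envelopingSemigroup g⟩, rfl⟩

/-- A distal system with a dense orbit is minimal: orbit closures are orbits of the group
`E(X, Γ)`, hence they partition the space. -/
theorem IsDistal.isMinimal_of_dense_orbit [UniformSpace X] [T2Space X] [CompactSpace X]
    [ContinuousConstSMul Γ X] (hd : IsDistal Γ X) {x₀ : X}
    (h : Dense (MulAction.orbit Γ x₀)) : MulAction.IsMinimal Γ X := by
  refine ⟨fun y => ?_⟩
  have hy : ∀ y, y ∈ range (fun p : envelopingSemigroup Γ X => p.1 x₀) := by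
    rw [range_eval_eq_closure_orbit, h.closure_eq]
    exact mem_univ
  obtain ⟨p, rfl⟩ := hy y
  obtain ⟨q, hq, hqp, -⟩ := hd.exists_inverse p.2
  intro z
  obtain ⟨r, rfl⟩ := hy z
  rw [← range_eval_eq_closure_orbit]
  exact ⟨r * ⟨q, hq⟩, congrArg r.1 (congrFun hqp x₀)⟩

end Ellis

/-! ### Pointwise limits of sequences of continuous maps -/

section BaireOne

/-- A pointwise limit of a sequence of continuous maps from a Baire space to a metric space is
continuous at the points of a residual set. -/
theorem eventually_residual_continuousAt {Z Y : Type*} [TopologicalSpace Z] [BaireSpace Z]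
    [PseudoMetricSpace Y] {f : ℕ → Z → Y} {g : Z → Y} (hf : ∀ n, Continuous (f n))
    (hg : ∀ z, Tendsto (fun n => f n z) atTop (𝓝 (g z))) :
    ∀ᶠ z in residual Z, ContinuousAt g z := by
  -- On `A ε n` the map `g` is uniformly `ε`-close to the continuous map `f n`.
  let A : ℝ → ℕ → Set Z := fun ε n => {z | ∀ m, n ≤ m → dist (f n z) (f m z) ≤ ε}
  have hA : ∀ ε n, IsClosed (A ε n) := fun ε n => by
    simp only [A, ofPred_forall]
    exact isClosed_iInter fun m => isClosed_iInter fun _ =>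
      isClosed_le ((hf n).dist (hf m)) continuous_const
  have hU : ∀ ε, 0 < ε → ⋃ n, A ε n = univ := fun ε hε => by
    refine eq_univ_of_forall fun z => mem_iUnion.mpr ?_
    obtain ⟨N, hN⟩ := Metric.cauchySeq_iff.mp (hg z).cauchySeq ε hε
    exact ⟨N, fun m hm => (hN N le_rfl m hm).le⟩
  have hres : ∀ k : ℕ, ∀ᶠ z in residual Z, z ∈ ⋃ n, interior (A (1 / (k + 1)) n) := fun k =>
    residual_of_dense_open (isOpen_iUnion fun _ => isOpen_interior)
      (dense_iUnion_interior_of_closed (hA _) (hU _ Nat.one_div_pos_of_nat))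
  filter_upwards [eventually_countable_forall.mpr hres] with z hz
  rw [Metric.continuousAt_iff']
  intro ε hε
  obtain ⟨k, hk⟩ := exists_nat_one_div_lt (show 0 < ε / 3 by positivity)
  obtain ⟨n, hn⟩ := mem_iUnion.mp (hz k)
  have hgA : ∀ w ∈ A (1 / (k + 1)) n, dist (f n w) (g w) ≤ 1 / (k + 1) := fun w hw =>
    le_of_tendsto ((tendsto_const_nhds (x := f n w)).dist (hg w))
      (eventually_atTop.mpr ⟨n, fun m hm => hw m hm⟩)
  filter_upwards [isOpen_interior.mem_nhds hn,
    Metric.continuousAt_iff'.mp (hf n).continuousAt (ε / 3) (by positivity)] with w hw hw'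
  have h1 := hgA w (interior_subset hw)
  have h2 := hgA z (interior_subset hn)
  have h3 := dist_triangle4 (g w) (f n w) (f n z) (g z)
  rw [dist_comm (g w) (f n w)] at h3
  linarith

end BaireOne

/-! ### Equicontinuity and continuity of the elements of the enveloping semigroup -/

section Equi

variable {Γ X : Type*} [Group Γ] [MulAction Γ X] [MetricSpace X] [CompactSpace X]

/-- An equicontinuous system is tame: the maps in `E(X, Γ)` are continuous, hence determined by
their values on a countable dense set, so that `E(X, Γ)` is compact and metrizable. -/
theorem IsEquicontinuous.isTame (h : IsEquicontinuous Γ X) : IsTame Γ X := by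
  have hE : ∀ p ∈ envelopingSemigroup Γ X, Continuous p := fun p hp =>
    ((equicontinuous_iff_range.mp h).closure).continuous ⟨p, hp⟩
  obtain ⟨D, hDc, hD⟩ := TopologicalSpace.exists_countable_dense X
  have := hDc.to_subtype
  have hc : Continuous (fun (p : envelopingSemigroup Γ X) (x : D) => p.1 x) :=
    continuous_pi fun x => (continuous_apply x.1).comp continuous_subtype_val
  have hi : Function.Injective (fun (p : envelopingSemigroup Γ X) (x : D) => p.1 x) :=
    fun p q hpq => Subtype.ext
      ((hE p p.2).ext_on hD (hE q q.2) fun x hx => congrFun hpq ⟨x, hx⟩)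
  have hemb := (hc.isClosedEmbedding hi).isEmbedding
  have : SecondCountableTopology (envelopingSemigroup Γ X) := hemb.secondCountableTopology
  exact ⟨inferInstance, inferInstance⟩

variable [ContinuousConstSMul Γ X]

/-- If the enveloping semigroup of a distal system consists of continuous maps, then the action
is equicontinuous. By Baire's theorem the evaluation `(p, y) ↦ p y` is jointly continuous at
`(q₀, x₀)` for some `q₀ ∈ E(X, Γ)`; the homeomorphisms in the group `E(X, Γ)` carry this to all
`(q, x₀)`, and `E(X, Γ)` is compact. -/
theorem IsDistal.isEquicontinuous_of_continuous (hd : IsDistal Γ X)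
    (hc : ∀ p ∈ envelopingSemigroup Γ X, Continuous p) : IsEquicontinuous Γ X := by
  intro x₀
  -- On `A ε n` the maps are equicontinuous at `x₀`, up to `ε`.
  let A : ℝ → ℕ → Set (envelopingSemigroup Γ X) := fun ε n =>
    {p | ∀ y, dist y x₀ < 1 / (n + 1) → dist (p.1 y) (p.1 x₀) ≤ ε}
  have hev : ∀ y, Continuous (fun p : envelopingSemigroup Γ X => p.1 y) := fun y =>
    (continuous_apply y).comp continuous_subtype_val
  have hA : ∀ ε n, IsClosed (A ε n) := fun ε n => by
    simp only [A, ofPred_forall]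
    exact isClosed_iInter fun y => isClosed_iInter fun _ =>
      isClosed_le ((hev y).dist (hev x₀)) continuous_const
  have hU : ∀ ε, 0 < ε → ⋃ n, A ε n = univ := fun ε hε => by
    refine eq_univ_of_forall fun p => mem_iUnion.mpr ?_
    obtain ⟨δ, hδ, h⟩ := Metric.continuous_iff.mp (hc p p.2) x₀ ε hε
    obtain ⟨n, hn⟩ := exists_nat_one_div_lt hδ
    exact ⟨n, fun y hy => (h y (hy.trans hn)).le⟩
  have hres : ∀ k : ℕ, ∀ᶠ p in residual (envelopingSemigroup Γ X),
      p ∈ ⋃ n, interior (A (1 / (k + 1)) n) := fun k =>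
    residual_of_dense_open (isOpen_iUnion fun _ => isOpen_interior)
      (dense_iUnion_interior_of_closed (hA _) (hU _ Nat.one_div_pos_of_nat))
  obtain ⟨q₀, hq₀⟩ := (dense_of_mem_residual (eventually_countable_forall.mpr hres)).nonempty
  have H : ∀ ε > 0, ∀ q : envelopingSemigroup Γ X, ∃ δ > 0, ∀ᶠ p in 𝓝 q,
      ∀ y, dist y x₀ < δ → dist (p.1 y) (p.1 x₀) < ε := by
    intro ε hε q
    obtain ⟨r, hr, hrq, -⟩ := hd.exists_inverse q₀.2
    obtain ⟨s, hs, hsq, hqs⟩ := hd.exists_inverse q.2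
    -- Left multiplication by `b = q₀ q⁻¹` maps `q` to `q₀`, and it is inverted by `a = q q₀⁻¹`.
    set a : X → X := q.1 ∘ r
    set b : envelopingSemigroup Γ X := q₀ * ⟨s, hs⟩
    have hab : ∀ x, a (b.1 x) = x := fun x => by
      change q.1 (r (q₀.1 (s x))) = x
      rw [show r (q₀.1 (s x)) = s x from congrFun hrq _]
      exact congrFun hqs x
    have hbq : b * q = q₀ := Subtype.ext (funext fun x => congrArg q₀.1 (congrFun hsq x))
    have ha : Continuous a := hc _ (comp_mem_envelopingSemigroup q.2 hr)
    have hb : Continuous (fun p : envelopingSemigroup Γ X => b * p) :=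
      continuous_induced_rng.mpr (continuous_pi fun x => (hc b b.2).comp (hev x))
    obtain ⟨η, hη, hau⟩ := Metric.uniformContinuous_iff.mp
      (CompactSpace.uniformContinuous_of_continuous ha) ε hε
    obtain ⟨k, hk⟩ := exists_nat_one_div_lt hη
    obtain ⟨n, hn⟩ := mem_iUnion.mp (hq₀ k)
    refine ⟨1 / (n + 1), Nat.one_div_pos_of_nat, ?_⟩
    have hn' : interior (A (1 / (k + 1)) n) ∈ 𝓝 (b * q) := by
      rw [hbq]
      exact isOpen_interior.mem_nhds hn
    filter_upwards [hb.continuousAt hn'] with p hp y hy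
    have := hau ((interior_subset hp y hy).trans_lt hk)
    rwa [show a ((b * p).1 y) = p.1 y from hab _, show a ((b * p).1 x₀) = p.1 x₀ from hab _]
      at this
  rw [Metric.equicontinuousAt_iff_right]
  intro ε hε
  choose δ hδ hV using H ε hε
  obtain ⟨t, -, ht⟩ := isCompact_univ.elim_nhds_subcover _ (fun q _ => hV q)
  filter_upwards [(eventually_all_finset t).mpr fun q _ => Metric.ball_mem_nhds x₀ (hδ q)]
    with y hy g
  obtain ⟨q, hq, hqg⟩ := mem_iUnion₂.mp
    (ht (mem_univ ⟨fun x => g • x, smul_mem_envelopingSemigroup g⟩))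
  rw [dist_comm]
  exact hqg y (hy q hq)

end Equi

/-! ### Tame distal systems -/

section Tame

variable {Γ X : Type*} [Group Γ] [MulAction Γ X]

/-- In a tame system the elements of the enveloping semigroup are limits of sequences of
translations. -/
theorem IsTame.exists_seq_tendsto [TopologicalSpace X] (ht : IsTame Γ X) {p : X → X}
    (hp : p ∈ envelopingSemigroup Γ X) :
    ∃ g : ℕ → Γ, ∀ x, Tendsto (fun n => g n • x) atTop (𝓝 (p x)) := by
  have := ht.2
  have hcl : (⟨p, hp⟩ : envelopingSemigroup Γ X) ∈
      closure {q | q.1 ∈ range (fun (g : Γ) (x : X) => g • x)} := by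
    rw [closure_subtype]
    refine closure_mono ?_ hp
    rintro _ ⟨g, rfl⟩
    exact ⟨⟨_, smul_mem_envelopingSemigroup g⟩, ⟨g, rfl⟩, rfl⟩
  obtain ⟨u, hu, hlim⟩ := mem_closure_iff_seq_limit.mp hcl
  choose g hg using hu
  refine ⟨g, fun x => ?_⟩
  have h := (((continuous_apply x).comp continuous_subtype_val).tendsto _).comp hlim
  refine h.congr fun n => ?_
  exact (congrFun (hg n) x).symm

variable [MetricSpace X] [CompactSpace X] [ContinuousConstSMul Γ X]

/-- The points which some `p ∈ E(X, Γ)` fixing `F` pointwise moves by at least `ε`, and keeps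
that far apart under all of `E(X, Γ)`. -/
def movable (Γ : Type*) {X : Type*} [Group Γ] [MulAction Γ X] [MetricSpace X] (ε : ℝ)
    (F : Set X) : Set X :=
  {x | ∃ p ∈ envelopingSemigroup Γ X, (∀ y ∈ F, p y = y) ∧
    ∀ u ∈ envelopingSemigroup Γ X, ε ≤ dist (u x) (u (p x))}

theorem movable_anti {ε ε' : ℝ} (hε : ε ≤ ε') {F F' : Set X} (h : F ⊆ F') :
    movable Γ ε' F' ⊆ movable Γ ε F :=
  fun _ ⟨p, hp, hf, hu⟩ => ⟨p, hp, fun y hy => hf y (h hy), fun u hu' => hε.trans (hu u hu')⟩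

/-- In a distal system the orbit of a pair of distinct points stays away from the diagonal, also
under the enveloping semigroup. -/
theorem IsDistal.exists_le_dist (hd : IsDistal Γ X) {x y : X} (hxy : x ≠ y) :
    ∃ k : ℕ, ∀ u ∈ envelopingSemigroup Γ X, 1 / ((k : ℝ) + 1) ≤ dist (u x) (u y) := by
  have h : ¬ Proximal Γ X x y := fun h => hxy (hd x y h)
  simp only [Proximal, not_forall, not_exists] at h
  obtain ⟨V, hV, h⟩ := h
  obtain ⟨ε, hε, hεV⟩ := Metric.mem_uniformity_dist.mp hV
  obtain ⟨k, hk⟩ := exists_nat_one_div_lt hε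
  refine ⟨k, fun u hu => hk.le.trans ?_⟩
  refine closure_minimal (s := range (fun (g : Γ) (x : X) => g • x))
    (t := {u | ε ≤ dist (u x) (u y)}) ?_
    (isClosed_le continuous_const ((continuous_apply x).dist (continuous_apply y))) hu
  rintro _ ⟨g, rfl⟩
  exact not_lt.mp fun hlt => h g (hεV hlt)

/-- If countable sets of fixed points do not determine the identity in `E(X, Γ)`, then for some
`ε > 0` there is a nonempty set `C` such that near every point of `C` there are points
of `C` that can be `ε`-moved by elements fixing a prescribed countable set. -/
theorem exists_robustly_movable (hd : IsDistal Γ X)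
    (H : ∀ F : Set X, F.Countable → ∃ p ∈ envelopingSemigroup Γ X, (∀ x ∈ F, p x = x) ∧ p ≠ id) :
    ∃ ε > 0, ∃ C : Set X, C.Nonempty ∧ ∀ x ∈ C, ∀ F : Set X, F.Countable → ∀ δ > 0,
      ∃ y ∈ C, dist y x < δ ∧ y ∈ movable Γ ε F := by
  obtain ⟨k, hk⟩ : ∃ k : ℕ, ∀ F : Set X, F.Countable →
      (movable Γ (1 / ((k : ℝ) + 1)) F).Nonempty := by
    by_contra! hcon
    choose F hF hFe using hcon
    obtain ⟨p, hp, hfix, hne⟩ := H (⋃ k, F k) (countable_iUnion hF)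
    obtain ⟨x, hx⟩ := Function.ne_iff.mp hne
    obtain ⟨k, hk⟩ := hd.exists_le_dist (Ne.symm hx)
    have : x ∈ movable Γ (1 / ((k : ℝ) + 1)) (F k) :=
      ⟨p, hp, fun y hy => hfix y (mem_iUnion.mpr ⟨k, hy⟩), hk⟩
    rw [hFe k] at this
    exact this
  set ε : ℝ := 1 / ((k : ℝ) + 1)
  -- Every basic open set that misses `movable ε F` for some countable `F` misses `movable ε F₁`.
  let b := TopologicalSpace.countableBasis X
  have hF : ∀ O : b, ∃ F : Set X, F.Countable ∧ ((∃ F' : Set X, F'.Countable ∧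
      O.1 ∩ movable Γ ε F' = ∅) → O.1 ∩ movable Γ ε F = ∅) := fun O => by
    by_cases h : ∃ F' : Set X, F'.Countable ∧ O.1 ∩ movable Γ ε F' = ∅
    · obtain ⟨F', hc, hF'⟩ := h
      exact ⟨F', hc, fun _ => hF'⟩
    · exact ⟨∅, countable_empty, fun h' => absurd h' h⟩
  choose F hFc hF using hF
  have : Countable b := TopologicalSpace.countable_countableBasis X
  have hF₁ : (⋃ O, F O).Countable := countable_iUnion hFc
  refine ⟨ε, Nat.one_div_pos_of_nat, movable Γ ε (⋃ O, F O), hk _ hF₁, fun x hx F' hF' δ hδ => ?_⟩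
  obtain ⟨O, hO, hxO, hOδ⟩ := (TopologicalSpace.isBasis_countableBasis X).mem_nhds_iff.mp
    (Metric.ball_mem_nhds x hδ)
  by_contra! hcon
  have hmiss : O ∩ movable Γ ε (F' ∪ ⋃ O, F O) = ∅ := by
    refine eq_empty_of_forall_notMem fun y hy => hcon y ?_ (hOδ hy.1) ?_
    · exact movable_anti le_rfl subset_union_right hy.2
    · exact movable_anti le_rfl subset_union_left hy.2
  have := hF ⟨O, hO⟩ ⟨_, hF'.union hF₁, hmiss⟩
  exact eq_empty_iff_forall_notMem.mp this x
    ⟨hxO, movable_anti le_rfl (subset_iUnion F ⟨O, hO⟩) hx⟩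

/-- One step of the construction: without changing `u` on the finite set `F`, points near those
of `F` are adjoined at which the values of the new `u` are far from the old values on `F`. -/
theorem exists_oscillating_extension {ε : ℝ} {C : Set X}
    (hC : ∀ x ∈ C, ∀ F : Set X, F.Countable → ∀ δ > 0,
      ∃ y ∈ C, dist y x < δ ∧ y ∈ movable Γ ε F)
    {δ : ℝ} (hδ : 0 < δ) {F : Set X} (hF : F.Finite) (hFC : F ⊆ C) {u : X → X}
    (hu : u ∈ envelopingSemigroup Γ X) :
    ∃ F' : Set X, F'.Finite ∧ F' ⊆ C ∧ F ⊆ F' ∧ ∃ u' ∈ envelopingSemigroup Γ X,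
      EqOn u' u F ∧ ∀ x ∈ F, ∃ y ∈ F', dist y x < δ ∧ ε / 2 ≤ dist (u' y) (u' x) := by
  suffices H : ∀ R : Set X, R.Finite → R ⊆ F → ∃ F' : Set X, F'.Finite ∧ F' ⊆ C ∧ F ⊆ F' ∧
      ∃ u' ∈ envelopingSemigroup Γ X, EqOn u' u F ∧
        ∀ x ∈ R, ∃ y ∈ F', dist y x < δ ∧ ε / 2 ≤ dist (u' y) (u' x) from H F hF subset_rfl
  intro R hR
  induction R, hR using Set.Finite.induction_on with
  | empty => exact fun _ => ⟨F, hF, hFC, subset_rfl, u, hu, fun _ _ => rfl, by simp⟩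
  | @insert r R _ _ ih =>
    intro hRF
    obtain ⟨F', hF', hFC', hFF', u', hu', heq, hosc⟩ := ih ((subset_insert r R).trans hRF)
    have hrF : r ∈ F := hRF (mem_insert r R)
    obtain ⟨y, hyC, hyr, p, hp, hfix, hmove⟩ := hC r (hFC hrF) F' hF'.countable δ hδ
    -- One of the values `u' y` and `u' (p y)` is far from `u' r`.
    obtain ⟨v, hv, hvF', hvy⟩ : ∃ v ∈ envelopingSemigroup Γ X, EqOn v u' F' ∧
        ε / 2 ≤ dist (v y) (u' r) := by
      by_cases h : ε / 2 ≤ dist (u' y) (u' r)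
      · exact ⟨u', hu', fun _ _ => rfl, h⟩
      · refine ⟨u' ∘ p, comp_mem_envelopingSemigroup hu' hp,
          fun x hx => congrArg u' (hfix x hx), ?_⟩
        have h1 := hmove u' hu'
        have h2 := dist_triangle_right (u' y) (u' (p y)) (u' r)
        simp only [Function.comp_apply]
        linarith [not_le.mp h]
    refine ⟨insert y F', hF'.insert y, insert_subset hyC hFC', hFF'.trans (subset_insert _ _),
      v, hv, fun x hx => (hvF' (hFF' hx)).trans (heq hx), ?_⟩
    rintro x (rfl | hx)
    · exact ⟨y, mem_insert _ _, hyr, by rwa [hvF' (hFF' hrF)]⟩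
    · obtain ⟨z, hz, hzx, h⟩ := hosc x hx
      refine ⟨z, mem_insert_of_mem _ hz, hzx, ?_⟩
      rwa [hvF' hz, hvF' (hFF' (hRF (mem_insert_of_mem _ hx)))]

/-- In a tame distal system, an element of the enveloping semigroup is determined by its values on
a suitable countable set. Otherwise one builds an element of the enveloping semigroup whose
restriction to a certain closed set is nowhere continuous, while it is the limit of a sequence of
continuous maps. -/
theorem IsTame.exists_countable_determining (ht : IsTame Γ X) (hd : IsDistal Γ X) :
    ∃ F : Set X, F.Countable ∧
      ∀ p ∈ envelopingSemigroup Γ X, (∀ x ∈ F, p x = x) → p = id := by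
  by_contra! H
  obtain ⟨ε, hε, C, ⟨c, hc⟩, hC⟩ := exists_robustly_movable hd H
  -- The `n`-th stage is a finite set `Fₙ ⊆ C` with a map `uₙ ∈ E(X, Γ)`; `uₙ` is never changed on
  -- `Fₙ` afterwards, and the values of `uₙ₊₁` on `Fₙ₊₁` oscillate near every point of `Fₙ`.
  let S := {s : Set X × (X → X) // s.1.Finite ∧ s.1 ⊆ C ∧ s.2 ∈ envelopingSemigroup Γ X}
  have hstep : ∀ (n : ℕ) (s : S), ∃ s' : S, s.1.1 ⊆ s'.1.1 ∧ EqOn s'.1.2 s.1.2 s.1.1 ∧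
      ∀ x ∈ s.1.1, ∃ y ∈ s'.1.1, dist y x < 1 / ((n : ℝ) + 1) ∧
        ε / 2 ≤ dist (s'.1.2 y) (s'.1.2 x) := by
    rintro n ⟨⟨F, u⟩, hF, hFC, hu⟩
    obtain ⟨F', hF', hFC', hFF', u', hu', heq, hosc⟩ :=
      exists_oscillating_extension hC (Nat.one_div_pos_of_nat (n := n)) hF hFC hu
    exact ⟨⟨⟨F', u'⟩, hF', hFC', hu'⟩, hFF', heq, hosc⟩
  choose next hsub heq hosc using hstep
  let s : ℕ → S := fun n => Nat.rec
    ⟨⟨{c}, id⟩, finite_singleton c, singleton_subset_iff.mpr hc, id_mem_envelopingSemigroup⟩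
    next n
  have hmono : Monotone fun n => (s n).1.1 := monotone_nat_of_le_succ fun n => hsub n (s n)
  have hstab : ∀ n m, n ≤ m → EqOn (s m).1.2 (s n).1.2 (s n).1.1 := by
    intro n m hnm
    induction m, hnm using Nat.le_induction with
    | base => exact fun _ _ => rfl
    | succ m hnm ih => exact fun x hx => (heq m (s m) (hmono hnm hx)).trans (ih hx)
  -- A cluster point `u` of the `uₙ` agrees with `uₙ` on `Fₙ`, so it oscillates by `ε / 2` near
  -- every point of the union of the `Fₙ`; but on the closure of this union it has a point of continuity.
  obtain ⟨u, hu, hlim⟩ := (isCompact_envelopingSemigroup (Γ := Γ) (X := X)).exists_mapClusterPt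
    (f := atTop) (u := fun n => (s n).1.2) (by simp [(s _).2.2.2])
  have huE : ∀ n, EqOn u (s n).1.2 (s n).1.1 := by
    intro n x hx
    exact (isClosed_eq (continuous_apply x) continuous_const :
      IsClosed {r : X → X | r x = (s n).1.2 x}).mem_of_mapClusterPt hlim
        (eventually_atTop.mpr ⟨n, fun m hm => hstab n m hm hx⟩)
  obtain ⟨g, hg⟩ := ht.exists_seq_tendsto hu
  let K := closure (⋃ n, (s n).1.1)
  have : CompactSpace K := isCompact_iff_compactSpace.mp isClosed_closure.isCompact
  have : Nonempty K := ⟨⟨c, subset_closure (mem_iUnion.mpr ⟨0, mem_singleton c⟩)⟩⟩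
  obtain ⟨z, hz : ContinuousAt (fun z : K => u z.1) z⟩ := (dense_of_mem_residual
    (eventually_residual_continuousAt
    (f := fun n (z : K) => g n • z.1) (g := fun z : K => u z.1)
    (fun n => (continuous_const_smul _).comp continuous_subtype_val) (fun z => hg z.1))).nonempty
  obtain ⟨δ, hδ, hosc'⟩ := Metric.continuousAt_iff.mp hz (ε / 4) (by positivity)
  obtain ⟨x, hx, hxz⟩ := Metric.mem_closure_iff.mp z.2 (δ / 2) (by positivity)
  obtain ⟨N, hN⟩ := mem_iUnion.mp hx
  obtain ⟨k, hk⟩ := exists_nat_one_div_lt (show 0 < δ / 2 by positivity)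
  set n := max N k
  have hxn : x ∈ (s n).1.1 := hmono (le_max_left N k) hN
  obtain ⟨y, hy, hyx, hfar⟩ := hosc n (s n) x hxn
  have hy' : y ∈ (s (n + 1)).1.1 := hy
  have hyx' : dist y x < δ / 2 := by
    refine hyx.trans (lt_of_le_of_lt (one_div_le_one_div_of_le (by positivity) ?_) hk)
    have : (k : ℝ) ≤ n := by exact_mod_cast le_max_right N k
    linarith
  have hux := huE (n + 1) (hmono (Nat.le_succ n) hxn)
  have huy := huE (n + 1) hy'
  have hfar' : ε / 2 ≤ dist (u y) (u x) := by
    rw [hux, huy]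
    exact hfar
  rw [dist_comm] at hxz
  have h1 : dist (u x) (u z.1) < ε / 4 := hosc' (x := ⟨x, subset_closure hx⟩) (by
    change dist x z.1 < δ
    linarith)
  have h2 : dist (u y) (u z.1) < ε / 4 :=
    hosc' (x := ⟨y, subset_closure (mem_iUnion.mpr ⟨n + 1, hy'⟩)⟩) (by
      change dist y z.1 < δ
      linarith [dist_triangle y x z.1])
  linarith [dist_triangle_right (u y) (u x) (u z.1)]

/-- In a tame distal system left multiplications of the enveloping semigroup are continuous.
Countably many coordinates suffice, so by Baire's theorem there is a point of continuity; right
multiplications, which are homeomorphisms commuting with left multiplications, carry it to every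
other point. -/
theorem IsTame.continuous_mul_left (ht : IsTame Γ X) (hd : IsDistal Γ X)
    (a : envelopingSemigroup Γ X) : Continuous (fun q => a * q) := by
  obtain ⟨F, hF, hdet⟩ := ht.exists_countable_determining hd
  have := hF.to_subtype
  have hev : ∀ x, Continuous (fun p : envelopingSemigroup Γ X => p.1 x) := fun x =>
    (continuous_apply x).comp continuous_subtype_val
  let e : envelopingSemigroup Γ X → (F → X) := fun p x => p.1 x
  have he : Continuous e := continuous_pi fun x => hev x.1
  have hinj : Function.Injective e := by
    intro p q hpq
    obtain ⟨r, hr, hrp, -⟩ := hd.exists_inverse p.2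
    have hrq : r ∘ q.1 = id := hdet _ (comp_mem_envelopingSemigroup hr q.2) fun x hx => by
      have h : p.1 x = q.1 x := congrFun hpq ⟨x, hx⟩
      rw [Function.comp_apply, ← h]
      exact congrFun hrp x
    exact Subtype.ext (funext fun x => hd.injective hr
      ((congrFun hrp x).trans (congrFun hrq x).symm))
  obtain ⟨g, hg⟩ := ht.exists_seq_tendsto a.2
  have hres : ∀ᶠ q in residual (envelopingSemigroup Γ X),
      ∀ x : F, ContinuousAt (fun q : envelopingSemigroup Γ X => a.1 (q.1 x)) q :=
    eventually_countable_forall.mpr fun x => eventually_residual_continuousAt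
      (fun n => (hev x).const_smul (g n)) (fun q => hg _)
  obtain ⟨q₀, hq₀⟩ := (dense_of_mem_residual hres).nonempty
  have hcont : ContinuousAt (fun q => a * q) q₀ :=
    ((he.isClosedEmbedding hinj).isInducing.continuousAt_iff).mpr (continuousAt_pi.mpr hq₀)
  refine continuous_iff_continuousAt.mpr fun q => ?_
  obtain ⟨r, hr, hrq, -⟩ := hd.exists_inverse q.2
  obtain ⟨r₀, hr₀, hrq₀, -⟩ := hd.exists_inverse q₀.2
  -- Right multiplication by `b = q⁻¹ q₀` maps `q` to `q₀`, and right
  -- multiplication by `c = b⁻¹` inverts it.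
  set b : envelopingSemigroup Γ X := ⟨r, hr⟩ * q₀
  set c : envelopingSemigroup Γ X := ⟨r₀, hr₀⟩ * q
  have hqb : q * b = q₀ := Subtype.ext (funext fun x => by
    change q.1 (r (q₀.1 x)) = q₀.1 x
    refine hd.injective hr ?_
    exact congrFun hrq _)
  have hbc : ∀ p, p * b * c = p := fun p => Subtype.ext (funext fun x => by
    change p.1 (r (q₀.1 (r₀ (q.1 x)))) = p.1 x
    have h : q₀.1 (r₀ (q.1 x)) = q.1 x := hd.injective hr₀ (congrFun hrq₀ _)
    rw [h]
    exact congrArg p.1 (congrFun hrq x))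
  have hcomp : ContinuousAt (fun p => a * (p * b) * c) q := by
    refine (continuous_mul_right c).continuousAt.comp ?_
    refine ContinuousAt.comp (g := fun q => a * q) ?_ (continuous_mul_right b).continuousAt
    rwa [hqb]
  refine hcomp.congr (Eventually.of_forall fun p => ?_)
  change a * (p * b) * c = a * p
  rw [mul_assoc, hbc]

/-- In a minimal tame distal system `X` is a quotient space of `E(X, Γ)`, so the elements of
`E(X, Γ)` inherit continuity from left multiplications. -/
theorem IsTame.continuous_of_mem (ht : IsTame Γ X) (hd : IsDistal Γ X)
    [hmin : MulAction.IsMinimal Γ X] {p : X → X} (hp : p ∈ envelopingSemigroup Γ X) :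
    Continuous p := by
  rcases isEmpty_or_nonempty X with hX | ⟨⟨x₀⟩⟩
  · exact continuous_of_const fun x => isEmptyElim x
  have hc : Continuous (fun q : envelopingSemigroup Γ X => q.1 x₀) :=
    (continuous_apply x₀).comp continuous_subtype_val
  have hs : Function.Surjective (fun q : envelopingSemigroup Γ X => q.1 x₀) := by
    rw [← range_eq_univ, range_eval_eq_closure_orbit]
    exact (MulAction.dense_orbit Γ x₀).closure_eq
  rw [(hc.isClosedMap.isQuotientMap hc hs).continuous_iff]
  exact hc.comp (ht.continuous_mul_left hd ⟨p, hp⟩)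

/-- A minimal distal system on a compact metric space is tame if and only if it is
equicontinuous. -/
theorem IsDistal.isTame_iff_isEquicontinuous (hd : IsDistal Γ X) [MulAction.IsMinimal Γ X] :
    IsTame Γ X ↔ IsEquicontinuous Γ X :=
  ⟨fun ht => hd.isEquicontinuous_of_continuous fun _ hp => ht.continuous_of_mem hd hp,
    IsEquicontinuous.isTame⟩

end Tame

/-! ### Dense orbits and injectivity -/

section Transitive

/-- A topologically transitive system on a second countable Baire space has a dense orbit. -/
theorem exists_dense_orbit (Γ X : Type*) [Group Γ] [TopologicalSpace X] [MulAction Γ X]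
    [ContinuousConstSMul Γ X] [SecondCountableTopology X] [BaireSpace X] [Nonempty X]
    [MulAction.IsTopologicallyTransitive Γ X] : ∃ x : X, Dense (MulAction.orbit Γ x) := by
  have hB := TopologicalSpace.isBasis_countableBasis X
  have : Countable (TopologicalSpace.countableBasis X) :=
    TopologicalSpace.countable_countableBasis X
  have hres : ∀ O : TopologicalSpace.countableBasis X, ∀ᶠ x in residual X,
      x ∈ ⋃ g : Γ, (g • ·) ⁻¹' O.1 := fun O =>
    have hO := hB.isOpen O.2
    residual_of_dense_open (isOpen_iUnion fun g => hO.preimage (continuous_const_smul g))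
      (hO.dense_iUnion_preimage_smul Γ (TopologicalSpace.nonempty_of_mem_countableBasis O.2))
  obtain ⟨x, hx⟩ := (dense_of_mem_residual (eventually_countable_forall.mpr hres)).nonempty
  refine ⟨x, hB.dense_iff.mpr fun O hO _ => ?_⟩
  obtain ⟨g, hg⟩ := mem_iUnion.mp (hx ⟨O, hO⟩)
  exact ⟨g • x, hg, g, rfl⟩

end Transitive

section Injective

variable {Γ X : Type*} [Group Γ] [MulAction Γ X] [MetricSpace X] [CompactSpace X]
  [MeasurableSpace X] [BorelSpace X] [ContinuousConstSMul Γ X]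

/-- For an injective distal system `E(M(X), Γ)` is a group, like `E(X, Γ)`. -/
theorem IsInjective.injective_of_isDistal (hi : IsInjective Γ X) (hd : IsDistal Γ X)
    (P : envelopingSemigroup Γ (ProbabilityMeasure X)) : Function.Injective P.1 := by
  obtain ⟨q, hq, hqp, -⟩ := hd.exists_inverse (naturalMap Γ X P).2
  obtain ⟨Q, hQ⟩ := hi.surjective ⟨q, hq⟩
  have hid : naturalMap Γ X ⟨id, id_mem_envelopingSemigroup⟩ =
      ⟨id, id_mem_envelopingSemigroup⟩ :=
    Subtype.ext (funext fun x => injective_diracProba (diracProba_restrictDirac _ x))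
  have hQP : Q * P = ⟨id, id_mem_envelopingSemigroup⟩ := by
    refine hi.injective ?_
    rw [map_mul, hQ, hid]
    exact Subtype.ext hqp
  have h : Q.1 ∘ P.1 = id := congrArg Subtype.val hQP
  exact Function.Injective.of_comp (f := Q.1) (h ▸ Function.injective_id)

end Injective

/-! ### The skew product on the two-torus -/

section Skew

variable (α : ℝ)

/-- The second coordinate of the `n`-th iterate of `skewHomeo α` at the origin. -/
noncomputable def skewOffset (n : ℤ) : UnitAddCircle := ((skewHomeo α ^ n) (0, 0)).2

theorem skewHomeo_zpow_apply (n : ℤ) (x y : UnitAddCircle) :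
    (skewHomeo α ^ n) (x, y) = (x + n • (α : UnitAddCircle), y + n • x + skewOffset α n) := by
  suffices H : ∃ c, ∀ x y : UnitAddCircle,
      (skewHomeo α ^ n) (x, y) = (x + n • (α : UnitAddCircle), y + n • x + c) by
    obtain ⟨c, hc⟩ := H
    have h0 : skewOffset α n = c := by simp [skewOffset, hc]
    rw [hc, h0]
  induction n using Int.induction_on with
  | zero => exact ⟨0, fun x y => by simp⟩
  | succ n ih =>
    obtain ⟨c, hc⟩ := ih
    refine ⟨c + n • (α : UnitAddCircle), fun x y => ?_⟩
    rw [zpow_add_one]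
    change (skewHomeo α ^ (n : ℤ)) (x + α, y + x) = _
    rw [hc]
    ext
    · simp only [add_smul, one_smul, natCast_zsmul]
      abel
    · simp only [add_smul, one_smul, natCast_zsmul, smul_add]
      abel
  | pred n ih =>
    obtain ⟨c, hc⟩ := ih
    refine ⟨c + n • (α : UnitAddCircle) + α, fun x y => ?_⟩
    rw [zpow_sub_one]
    change (skewHomeo α ^ (-n : ℤ)) (x - α, y - (x - α)) = _
    rw [hc]
    ext
    · simp only [sub_smul, one_smul, natCast_zsmul, neg_smul]
      abel
    · simp only [sub_smul, one_smul, natCast_zsmul, neg_smul, smul_sub]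
      abel

/-- The point of `SkewTorus α` with the given coordinates. -/
def skewPoint (x y : UnitAddCircle) : SkewTorus α := (x, y)

theorem continuous_skewPoint : Continuous (fun z : UnitAddCircle × UnitAddCircle =>
    skewPoint α z.1 z.2) :=
  continuous_id

theorem dist_skewPoint (x y x' y' : UnitAddCircle) :
    dist (skewPoint α x y) (skewPoint α x' y') = max (dist x x') (dist y y') :=
  rfl

theorem smul_skewPoint (n : ℤ) (x y : UnitAddCircle) :
    Multiplicative.ofAdd n • skewPoint α x y =
      skewPoint α (x + n • (α : UnitAddCircle)) (y + n • x + skewOffset α n) :=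
  skewHomeo_zpow_apply α n x y

theorem dist_smul_skewPoint (n : ℤ) (x y x' y' : UnitAddCircle) :
    dist (Multiplicative.ofAdd n • skewPoint α x y) (Multiplicative.ofAdd n • skewPoint α x' y') =
      max (dist x x') (dist (y + n • x) (y' + n • x')) := by
  rw [smul_skewPoint, smul_skewPoint, dist_skewPoint, dist_add_right, dist_add_right]

theorem skewTorus_isDistal : IsDistal (Multiplicative ℤ) (SkewTorus α) := by
  rintro ⟨x, y⟩ ⟨x', y'⟩ h
  have h' : ∀ ε > 0, ∃ n : ℤ, max (dist x x') (dist (y + n • x) (y' + n • x')) < ε := by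
    intro ε hε
    obtain ⟨n, hn⟩ := h _ (Metric.dist_mem_uniformity hε)
    refine ⟨n.toAdd, ?_⟩
    rw [← dist_smul_skewPoint α]
    exact hn
  have hx : x = x' := eq_of_forall_dist_le fun ε hε => by
    obtain ⟨n, hn⟩ := h' ε hε
    exact (le_max_left _ _).trans hn.le
  subst hx
  have hy : y = y' := eq_of_forall_dist_le fun ε hε => by
    obtain ⟨n, hn⟩ := h' ε hε
    rw [dist_add_right] at hn
    exact (le_max_right _ _).trans hn.le
  rw [hy]

/-- The `n`-fold multiple of the point `1 / (2 n)` of the circle is the antipode of `0`. -/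
theorem nsmul_half_div (n : ℕ) (hn : n ≠ 0) :
    (n : ℤ) • ((1 / 2 / n : ℝ) : UnitAddCircle) = ((1 / 2 : ℝ) : UnitAddCircle) := by
  rw [← AddCircle.coe_zsmul]
  congr 1
  simp only [zsmul_eq_mul, Int.cast_natCast]
  field_simp

theorem norm_coe_half : ‖((1 / 2 : ℝ) : UnitAddCircle)‖ = 1 / 2 := by
  simpa using AddCircle.norm_half_period_eq 1

theorem tendsto_coe_half_div :
    Tendsto (fun n : ℕ => ((1 / 2 / n : ℝ) : UnitAddCircle)) atTop (𝓝 0) :=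
  (AddCircle.continuous_mk' 1).tendsto' 0 0 rfl |>.comp
    (tendsto_const_div_atTop_nhds_zero_nat (1 / 2))

theorem skewTorus_not_isEquicontinuous :
    ¬ IsEquicontinuous (Multiplicative ℤ) (SkewTorus α) := by
  intro h
  obtain ⟨δ, hδ, h⟩ := Metric.equicontinuousAt_iff.mp (h (skewPoint α 0 0)) (1 / 2) (by norm_num)
  obtain ⟨n, hn, hn0⟩ := ((Metric.tendsto_nhds.mp tendsto_coe_half_div δ hδ).and
    (eventually_ne_atTop 0)).exists
  have := h (skewPoint α ((1 / 2 / n : ℝ) : UnitAddCircle) 0) (by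
    rw [dist_skewPoint, dist_self]
    exact max_lt hn hδ) (Multiplicative.ofAdd (n : ℤ))
  rw [dist_smul_skewPoint, nsmul_half_div n hn0] at this
  have h2 := (le_max_right _ _).trans_lt this
  rw [smul_zero, zero_add, zero_add, dist_zero_left, norm_coe_half] at h2
  exact lt_irrefl _ h2

variable {α}

theorem frequently_nsmul_mem (hα : Irrational α) {U : Set UnitAddCircle} (hU : IsOpen U)
    (hne : U.Nonempty) : ∃ᶠ n : ℕ in atTop, n • (α : UnitAddCircle) ∈ U := by
  obtain ⟨x, hx⟩ := hne
  have hd : DenseRange (· • (α : UnitAddCircle) : ℤ → UnitAddCircle) :=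
    AddCircle.denseRange_zsmul_coe_iff.mpr (by simpa using hα)
  have : MapClusterPt x atTop (fun n : ℕ => n • (α : UnitAddCircle)) :=
    mapClusterPt_atTop_nsmul_iff_mem_topologicalClosure_zmultiples.mpr (hd x)
  exact this.frequently (hU.mem_nhds hx)

/-- An iterate of high order stretches short horizontal segments around the vertical circle, and
the rotation by `α` brings them close to any vertical line. -/
theorem skewTorus_isTopologicallyTransitive (hα : Irrational α) :
    MulAction.IsTopologicallyTransitive (Multiplicative ℤ) (SkewTorus α) := by
  refine ⟨fun {U V} hU hUne hV hVne => ?_⟩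
  obtain ⟨⟨x₀, y₀⟩, h₀⟩ := hUne
  obtain ⟨⟨x₁, y₁⟩, h₁⟩ := hVne
  obtain ⟨δ, hδ, hδU⟩ := Metric.isOpen_iff.mp hU _ h₀
  obtain ⟨η, hη, hηV⟩ := Metric.isOpen_iff.mp hV _ h₁
  have hfreq := frequently_nsmul_mem hα (Metric.isOpen_ball (x := x₁ - x₀) (ε := η / 2))
    ⟨_, Metric.mem_ball_self (half_pos hη)⟩
  have hsmall : ∀ᶠ n : ℕ in atTop, (1 : ℝ) / n < min δ (η / 2) :=
    (tendsto_const_div_atTop_nhds_zero_nat 1).eventually_lt_const (by positivity)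
  obtain ⟨n, hn, hnlt, hn0⟩ := (hfreq.and_eventually
    (hsmall.and (eventually_ne_atTop 0))).exists
  -- Moving `x₀` by `s = t / n` corrects the second coordinate of the image exactly.
  obtain ⟨t, ht, hty⟩ := AddCircle.eq_coe_Ico (p := (1 : ℝ))
    (y₁ - (y₀ + (n : ℤ) • x₀ + skewOffset α n))
  set s : UnitAddCircle := ((t / n : ℝ) : UnitAddCircle)
  have hns : (n : ℤ) • s = y₁ - (y₀ + (n : ℤ) • x₀ + skewOffset α n) := by
    rw [← hty, ← AddCircle.coe_zsmul]
    congr 1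
    simp only [zsmul_eq_mul, Int.cast_natCast]
    field_simp
  have hs : ‖s‖ ≤ 1 / n := by
    refine (QuotientAddGroup.norm_mk_le_norm (S := AddSubgroup.zmultiples (1 : ℝ))).trans ?_
    rw [Real.norm_of_nonneg (by have := ht.1; positivity)]
    gcongr
    exact ht.2.le
  refine ⟨Multiplicative.ofAdd (n : ℤ), Multiplicative.ofAdd (n : ℤ) • skewPoint α (x₀ + s) y₀,
    ⟨_, hδU ?_, rfl⟩, hηV ?_⟩
  · change dist (skewPoint α (x₀ + s) y₀) (skewPoint α x₀ y₀) < δ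
    rw [dist_skewPoint, dist_self, dist_self_add_left]
    exact max_lt (hs.trans_lt (hnlt.trans_le (min_le_left _ _))) hδ
  · change dist (Multiplicative.ofAdd (n : ℤ) • skewPoint α (x₀ + s) y₀) (skewPoint α x₁ y₁) < η
    rw [smul_skewPoint, dist_skewPoint, smul_add, hns]
    refine max_lt ?_ ?_
    · rw [mem_ball_iff_norm] at hn
      rw [dist_eq_norm, natCast_zsmul,
        show x₀ + s + n • (α : UnitAddCircle) - x₁ = (n • (α : UnitAddCircle) - (x₁ - x₀)) + s by
          abel]
      have := hnlt.trans_le (min_le_right _ _)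
      linarith [norm_add_le (n • (α : UnitAddCircle) - (x₁ - x₀)) s]
    · rw [show y₀ + ((n : ℤ) • x₀ + (y₁ - (y₀ + (n : ℤ) • x₀ + skewOffset α n))) +
        skewOffset α n = y₁ by abel, dist_self]
      exact hη

theorem skewTorus_isMinimal (hα : Irrational α) :
    MulAction.IsMinimal (Multiplicative ℤ) (SkewTorus α) := by
  have := skewTorus_isTopologicallyTransitive hα
  have : Nonempty (SkewTorus α) := ⟨skewPoint α 0 0⟩
  obtain ⟨x, hx⟩ := exists_dense_orbit (Multiplicative ℤ) (SkewTorus α)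
  exact (skewTorus_isDistal α).isMinimal_of_dense_orbit hx

variable (α)

theorem continuous_skewPoint_left (y : UnitAddCircle) :
    Continuous (fun x : UnitAddCircle => skewPoint α x y) :=
  (continuous_skewPoint α).comp (by fun_prop : Continuous fun x : UnitAddCircle => (x, y))

instance isProbabilityMeasure_volume_unitAddCircle :
    IsProbabilityMeasure (volume : Measure UnitAddCircle) :=
  ⟨UnitAddCircle.measure_univ⟩

/-- Lebesgue measure on the horizontal circle of height `y`. -/
noncomputable def horizontalMeasure (y : UnitAddCircle) : ProbabilityMeasure (SkewTorus α) :=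
  ⟨Measure.map (fun x : UnitAddCircle => skewPoint α x y) volume,
    Measure.isProbabilityMeasure_map (continuous_skewPoint_left α y).measurable.aemeasurable⟩

theorem horizontalMeasure_ne {y y' : UnitAddCircle} (h : y ≠ y') :
    horizontalMeasure α y ≠ horizontalMeasure α y' := by
  intro heq
  have hcl : IsClosed (range fun x : UnitAddCircle => skewPoint α x y) :=
    (isCompact_range (continuous_skewPoint_left α y)).isClosed
  have h1 : (horizontalMeasure α y : Measure (SkewTorus α))
      (range fun x => skewPoint α x y) = 1 := by
    change Measure.map _ _ _ = _
    rw [Measure.map_apply (continuous_skewPoint_left α y).measurable hcl.measurableSet,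
      preimage_range, measure_univ]
  have h2 : (horizontalMeasure α y' : Measure (SkewTorus α))
      (range fun x => skewPoint α x y) = 0 := by
    change Measure.map _ _ _ = _
    rw [Measure.map_apply (continuous_skewPoint_left α y').measurable hcl.measurableSet]
    have : (fun x : UnitAddCircle => skewPoint α x y') ⁻¹'
        (range fun x => skewPoint α x y) = ∅ := by
      refine eq_empty_of_forall_notMem ?_
      rintro x ⟨x', hx'⟩
      exact h (congrArg Prod.snd hx')
    rw [this, measure_empty]
  rw [heq, h2] at h1
  exact zero_ne_one h1

theorem integral_smul_horizontalMeasure (n : ℤ) (y : UnitAddCircle) {f : SkewTorus α → ℝ}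
    (hf : Continuous f) :
    ∫ z, f z ∂((Multiplicative.ofAdd n • horizontalMeasure α y :
      ProbabilityMeasure (SkewTorus α)) : Measure (SkewTorus α)) =
    ∫ x : UnitAddCircle, f (skewPoint α (x + n • (α : UnitAddCircle))
      (y + n • x + skewOffset α n)) := by
  have hT := continuous_const_smul (T := SkewTorus α) (Multiplicative.ofAdd n)
  change ∫ z, f z ∂(Measure.map (fun z => Multiplicative.ofAdd n • z) (Measure.map _ volume)) = _
  rw [integral_map hT.measurable.aemeasurable hf.aestronglyMeasurable,
    integral_map (continuous_skewPoint_left α y).measurable.aemeasurable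
      (f := fun z => f (Multiplicative.ofAdd n • z)) (hf.comp hT).aestronglyMeasurable]
  simp only [smul_skewPoint]

/-- Translating the circle by `1 / (2 n)` raises the image of the circle of height `0` under the
`n`-th iterate by `1 / 2`, up to an error which tends to `0`. -/
theorem tendsto_integral_sub_integral {f : SkewTorus α → ℝ} (hf : Continuous f) :
    Tendsto (fun n : ℕ =>
      ∫ z, f z ∂((Multiplicative.ofAdd (n : ℤ) • horizontalMeasure α 0 :
        ProbabilityMeasure (SkewTorus α)) : Measure (SkewTorus α)) -
      ∫ z, f z ∂((Multiplicative.ofAdd (n : ℤ) •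
        horizontalMeasure α ((1 / 2 : ℝ) : UnitAddCircle) :
        ProbabilityMeasure (SkewTorus α)) : Measure (SkewTorus α))) atTop (𝓝 0) := by
  rw [Metric.tendsto_nhds]
  intro ε hε
  obtain ⟨δ, hδ, hfu⟩ := Metric.uniformContinuous_iff.mp
    (CompactSpace.uniformContinuous_of_continuous hf) (ε / 2) (half_pos hε)
  filter_upwards [Metric.tendsto_nhds.mp tendsto_coe_half_div δ hδ, eventually_ne_atTop 0]
    with n hn hn0
  have hint : ∀ g : UnitAddCircle → UnitAddCircle × UnitAddCircle, Continuous g →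
      Integrable (fun x => f (skewPoint α (g x).1 (g x).2)) volume := fun g hg =>
    (hf.comp ((continuous_skewPoint α).comp hg)).integrable_of_hasCompactSupport
      (HasCompactSupport.of_compactSpace _)
  set s : UnitAddCircle := ((1 / 2 / n : ℝ) : UnitAddCircle)
  rw [dist_zero_right, integral_smul_horizontalMeasure α _ _ hf,
    integral_smul_horizontalMeasure α _ _ hf, ← integral_add_right_eq_self _ s,
    ← integral_sub (hint (fun x => (_, _)) (by fun_prop)) (hint (fun x => (_, _)) (by fun_prop))]
  refine (norm_integral_le_of_norm_le_const (C := ε / 2)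
    (Eventually.of_forall fun x => ?_)).trans_lt ?_
  · rw [smul_add, nsmul_half_div n hn0, ← dist_eq_norm]
    refine (hfu ?_).le
    rw [dist_skewPoint, show (0 : UnitAddCircle) + ((n : ℤ) • x + ((1 / 2 : ℝ) : UnitAddCircle)) =
      ((1 / 2 : ℝ) : UnitAddCircle) + (n : ℤ) • x by abel, dist_self, dist_add_right,
      dist_self_add_left]
    exact max_lt (by simpa using hn) hδ
  · rw [probReal_univ, mul_one]
    exact half_lt_self hε

theorem skewTorus_not_isInjective : ¬ IsInjective (Multiplicative ℤ) (SkewTorus α) := by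
  intro hi
  let M := ProbabilityMeasure (SkewTorus α)
  let T : ℕ → M → M := fun n μ => Multiplicative.ofAdd (n : ℤ) • μ
  obtain ⟨P, hP, hlim⟩ := (isCompact_envelopingSemigroup (Γ := Multiplicative ℤ)
    (X := M)).ultrafilter_le_nhds' ((hyperfilter ℕ).map T)
    (Filter.mem_map.mpr <| univ_mem' fun n : ℕ =>
      smul_mem_envelopingSemigroup (Multiplicative.ofAdd (n : ℤ)))
  have hlimP : ∀ μ, Tendsto (fun n => T n μ) (hyperfilter ℕ : Filter ℕ) (𝓝 (P μ)) := fun μ =>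
    ((continuous_apply μ).tendsto P).comp hlim
  have hle : (hyperfilter ℕ : Filter ℕ) ≤ atTop := Nat.hyperfilter_le_atTop
  have hPeq : P (horizontalMeasure α 0) =
      P (horizontalMeasure α ((1 / 2 : ℝ) : UnitAddCircle)) := by
    have (μ : M) : IsProbabilityMeasure μ.1 := μ.2
    refine Subtype.ext (ext_of_forall_integral_eq_of_IsFiniteMeasure fun f => ?_)
    have h := fun μ => (ProbabilityMeasure.tendsto_iff_forall_integral_tendsto.mp (hlimP μ)) f
    exact sub_eq_zero.mp (tendsto_nhds_unique ((h _).sub (h _))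
      ((tendsto_integral_sub_integral α f.continuous).mono_left hle))
  refine horizontalMeasure_ne α ?_
    (hi.injective_of_isDistal (skewTorus_isDistal α) ⟨P, hP⟩ hPeq)
  intro h
  have := norm_coe_half
  rw [← h, norm_zero] at this
  norm_num at this

end Skew

end TopDyn

theorem mainTheorem2 :
    (∀ (Γ : Type*) (X : Type*) [Group Γ] [TopologicalSpace Γ] [IsTopologicalGroup Γ]
        [MetricSpace X] [CompactSpace X] [MulAction Γ X] [ContinuousSMul Γ X],
        MulAction.IsMinimal Γ X → TopDyn.IsDistal Γ X →
          (TopDyn.IsTame Γ X ↔ TopDyn.IsEquicontinuous Γ X)) ∧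
    (∀ α : ℝ, Irrational α →
        MulAction.IsMinimal (Multiplicative ℤ) (TopDyn.SkewTorus α) ∧
        TopDyn.IsDistal (Multiplicative ℤ) (TopDyn.SkewTorus α) ∧
        ¬ TopDyn.IsEquicontinuous (Multiplicative ℤ) (TopDyn.SkewTorus α) ∧
        ¬ TopDyn.IsTame (Multiplicative ℤ) (TopDyn.SkewTorus α) ∧
        ¬ TopDyn.IsInjective (Multiplicative ℤ) (TopDyn.SkewTorus α)) := by
  refine ⟨fun Γ X _ _ _ _ _ _ _ _ hd => hd.isTame_iff_isEquicontinuous, fun α hα => ?_⟩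
  have hmin := TopDyn.skewTorus_isMinimal hα
  have hd := TopDyn.skewTorus_isDistal α
  have hne := TopDyn.skewTorus_not_isEquicontinuous α
  exact ⟨hmin, hd, hne, fun ht => hne (hd.isTame_iff_isEquicontinuous.mp ht),
    TopDyn.skewTorus_not_isInjective α⟩
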